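/- For $n,v\in\mathbb N$ let $\mathrm{RM}(n,v)\subseteq\mathbb F_2^{2^n}$ be the Reed--Muller code whose codewords are the evaluation vectors $(f(x))_{x\in\mathbb F_2^n}$ of the polynomials $f$ over $\mathbb F_2$ in $n$ variables of degree at most $v$; its rate is $\dim \mathrm{RM}(n,v)/2^n$. A binary memoryless symmetric (BMS) channel with output alphabet $\mathcal Y$ is given by two probability measures $p(\cdot\mid 0)$, $p(\cdot\mid 1)$ on $\mathcal Y$ that are exchanged by a measurable involution of $\mathcal Y$; successive bits are sent independently. With $p(y\mid 0),p(y\mid 1)$ also denoting densities with respect to a common dominating measure, its Bhattacharyya parameter is $z=\int\sqrt{p(y\mid 0)\,p(y\mid 1)}\,dy$. A codeword is chosen uniformly at random and transmitted. The block-MAP decoder outputs a codeword of largest posterior probability given the output block, and $P_{\rm B}$ is the probability that it differs from the transmitted codeword. The bit-MAP decoder outputs, for each position, a bit value of largest posterior probability, and $P_{\rm b}$ is its probability of error averaged over the $2^n$ positions. In both cases ties are broken arbitrarily (but measurably). **Theorem.** Consider a sequence of codes $\mathrm{RM}(n,v_n)$, with $n$ strictly increasing along the sequence, whose rates converge to some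 $R\in(0,1)$. Let $z\in(0,1)$, and let each code be transmitted over a BMS channel with Bhattacharyya parameter $z$ (the channel may vary along the sequence, but $z$ is fixed). If, for some $\delta>0$, the bit error probability of the bit-MAP decoder satisfies $P_{\rm b}=O(2^{-n\delta})$ as $n\to\infty$, then the block error probability $P_{\rm B}$ of the block-MAP decoder tends to $0$ as $n\to\infty$. -/

import Mathlib

open MeasureTheory Filter Topology Asymptotics

noncomputable section

/-- The Reed-Muller code `RM(n, v)`: the evaluation vectors on `𝔽₂ⁿ` of the polynomials over `𝔽₂`
in `n` variables of total degree at most `v`. The coordinates of a codeword are indexed by the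
`2 ^ n` points of `𝔽₂ⁿ`. -/
def reedMuller (n v : ℕ) : Submodule (ZMod 2) ((Fin n → ZMod 2) → ZMod 2) :=
  (MvPolynomial.restrictTotalDegree (Fin n) (ZMod 2) v).map
    (MvPolynomial.evalₗ (ZMod 2) (Fin n))

/-- The rate (dimension over block length) of a binary linear code. -/
def codeRate {ι : Type*} [Fintype ι] (C : Submodule (ZMod 2) (ι → ZMod 2)) : ℝ :=
  (Module.finrank (ZMod 2) C : ℝ) / (Fintype.card ι : ℝ)

open Classical in
/-- The finite set of codewords of a binary linear code. -/
def codewords {ι : Type*} [Fintype ι] (C : Submodule (ZMod 2) (ι → ZMod 2)) :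
    Finset (ι → ZMod 2) :=
  Finset.univ.filter (fun x => x ∈ C)

/-- A binary-input symmetric channel with output alphabet `Y`: an output law for each input bit,
the two laws being exchanged by a measurable involution of the output alphabet. -/
structure BMSChannel (Y : Type*) [MeasurableSpace Y] where
  /-- the law of the channel output given the input bit -/
  law : ZMod 2 → Measure Y
  isProb : ∀ b, IsProbabilityMeasure (law b)
  symm : ∃ τ : Y → Y, Measurable τ ∧ Function.Involutive τ ∧ law 1 = (law 0).map τ

attribute [instance] BMSChannel.isProb

namespace BMSChannel

variable {Y : Type*} [MeasurableSpace Y] (W : BMSChannel Y)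

/-- The reference measure with respect to which transition densities are taken. -/
def ref : Measure Y := W.law 0 + W.law 1

/-- The transition density `p(y | b)` of the channel. -/
def density (b : ZMod 2) (y : Y) : ℝ := ((W.law b).rnDeriv W.ref y).toReal

/-- The Bhattacharyya parameter `∫ √(p(y | 0) p(y | 1)) dy`; it does not depend on the
reference measure. -/
def bhattacharyya : ℝ := ∫ y, √(W.density 0 y * W.density 1 y) ∂W.ref

variable {ι : Type*} [Fintype ι]

/-- The law of the output block when the word `x` is sent by independent uses of the channel. -/
def blockLaw (x : ι → ZMod 2) : Measure (ι → Y) := Measure.pi fun i => W.law (x i)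

/-- The density `p(y | x) = ∏ i, p(y i | x i)` of `blockLaw`. -/
def likelihood (x : ι → ZMod 2) (y : ι → Y) : ℝ := ∏ i, W.density (x i) (y i)

variable (C : Submodule (ZMod 2) (ι → ZMod 2))

/-- The posterior probability `p(x | y)` of the word `x` given the output `y`,
when the transmitted word is uniform on the code `C`. -/
def posterior (x : ι → ZMod 2) (y : ι → Y) : ℝ :=
  W.likelihood x y / ∑ x' ∈ codewords C, W.likelihood x' y

/-- The posterior probability that bit `i` of the transmitted codeword equals `b`,
given the output `y`. -/
def bitPosterior (i : ι) (b : ZMod 2) (y : ι → Y) : ℝ :=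
  ∑ x ∈ codewords C with x i = b, W.posterior C x y

/-- `d` is a block-MAP decoder: a measurable map outputting, for almost every output block, a
codeword of largest posterior probability (ties are broken arbitrarily). -/
structure IsBlockMAP (d : (ι → Y) → (ι → ZMod 2)) : Prop where
  measurable : ∀ x, MeasurableSet {y | d y = x}
  mem : ∀ y, d y ∈ C
  isMax : ∀ c ∈ C, ∀ᵐ y ∂(W.blockLaw c), ∀ x ∈ C, W.posterior C x y ≤ W.posterior C (d y) y

/-- `d` is a bit-MAP decoder: for each position `i`, the measurable map `d i` outputs, for almost
every output block, a value of bit `i` of largest posterior probability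
(ties are broken arbitrarily). -/
structure IsBitMAP (d : ι → (ι → Y) → ZMod 2) : Prop where
  measurable : ∀ i b, MeasurableSet {y | d i y = b}
  isMax : ∀ i, ∀ c ∈ C, ∀ᵐ y ∂(W.blockLaw c),
    ∀ b, W.bitPosterior C i b y ≤ W.bitPosterior C i (d i y) y

/-- The block error probability of the decoder `d`, for a uniform transmitted codeword. -/
def blockError (d : (ι → Y) → (ι → ZMod 2)) : ℝ :=
  (∑ x ∈ codewords C, (W.blockLaw x).real {y | d y ≠ x}) / ((codewords C).card : ℝ)

/-- The bit error probability of the decoder `d`, for a uniform transmitted codeword,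
averaged over the positions. -/
def bitError (d : ι → (ι → Y) → ZMod 2) : ℝ :=
  (∑ i, (∑ x ∈ codewords C, (W.blockLaw x).real {y | d i y ≠ x i}) / ((codewords C).card : ℝ)) /
    (Fintype.card ι : ℝ)

end BMSChannel

end

/-! ### Derandomizing a majority vote, and uniformity of random linear maps -/

section Majority

/-! Write `N = 2 ^ n`. The bitwise decisions form a word `b` at expected distance `N * P_b` from the
sent codeword, so by Markov the codeword lies within `ρ` of `b` except with probability `N * P_b /
(ρ + 1)`. Choosing the likeliest codeword within `ρ` of `b` then only confuses codewords at distance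
at most `2 * ρ`, and a union bound with Bhattacharyya weights costs the sum of `z ^ wt c` over
nonzero codewords of weight at most `2 * ρ`. Block-MAP is at least as good (`blockError_le`). With
`ρ` about `2 ^ (n * (1 - δ / 2))` the first term vanishes; the second needs a count of light
codewords.

The count (`card_hammingNorm_le`) is a sunflower argument. Split the variables into `k` and `n - k`.
If `f` has weight at most `2 ^ (n - k) / 6`, a random graph of a linear map, translated to pass
through `x`, meets the support of `f` away from `x` with probability at most `1 / 6`, so the sum of
`f` over it is usually `f x`. A majority over `3 * n` suitable maps recovers `f` everywhere
(`exists_majority_graphSum`). Each sum, as a function of the translation, has degree at most `v - k`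
in `n - k` variables, so `f` is encoded by few such polynomials; if `v < k` the sums vanish and `f =
0`.

A limiting rate below `1` forces `v ≤ (1 / 2 + η) * n` eventually. For `k ≥ 4 * η * n` the degree `v
- k` is then below half of `n - k` by a linear margin, so Hoeffding makes the logarithm of the count
`o(2 ^ (n - k))`, which `z ^ wt` beats on each dyadic weight range (`sum_pow_hammingNorm_le`,
`weight_exponent_le`). -/

theorem exists_tuple_forall_two_mul_card_lt {Ω X : Type*} [Fintype Ω] [Nonempty Ω] [Fintype X]
    (bad : X → Ω → Prop) [∀ x, DecidablePred (bad x)]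
    (h : ∀ x, 6 * (Finset.univ.filter (bad x)).card ≤ Fintype.card Ω) (t : ℕ)
    (ht : Fintype.card X * 3 ^ t < 4 ^ t) :
    ∃ B : Fin t → Ω, ∀ x, 2 * (Finset.univ.filter fun i => bad x (B i)).card < t := by
  classical
  by_contra! hcon
  have hone : ∀ x, (Finset.univ.filter fun B : Fin t → Ω =>
      t ≤ 2 * (Finset.univ.filter fun i => bad x (B i)).card).card * 4 ^ t
        ≤ 3 ^ t * Fintype.card Ω ^ t := by
    intro x
    -- Chernoff with weight `4` per bad index: a bad majority weighs at least `4 ^ (t / 2) = 2 ^ t`,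
    -- while the average weight is at most `(1 + 3 / 6) ^ t`. The failure probability per `x` is
    -- thus at most `(3 / 4) ^ t`.
    have h1 : (Finset.univ.filter fun B : Fin t → Ω =>
        t ≤ 2 * (Finset.univ.filter fun i => bad x (B i)).card).card * 2 ^ t
        ≤ ∑ B : Fin t → Ω, ∏ i, (if bad x (B i) then 4 else 1) := by
      rw [← smul_eq_mul, ← Finset.sum_const]
      refine (Finset.sum_le_sum (g := fun B : Fin t → Ω => ∏ i, (if bad x (B i) then 4 else 1))
        fun B hB => ?_).trans
        (Finset.sum_le_sum_of_subset (Finset.subset_univ _))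
      rw [Finset.prod_ite]
      simp only [Finset.prod_const, one_pow, mul_one]
      calc 2 ^ t ≤ 2 ^ (2 * (Finset.univ.filter fun i => bad x (B i)).card) :=
            Nat.pow_le_pow_right (by norm_num) (by simpa using hB)
        _ = _ := by rw [pow_mul]; norm_num
    have h2 : ∑ B : Fin t → Ω, ∏ i, (if bad x (B i) then 4 else 1)
        = (∑ ω : Ω, if bad x ω then 4 else 1) ^ t := by
      rw [Finset.sum_pow', ← Fintype.piFinset_univ]
    have h3 : 2 * (∑ ω : Ω, if bad x ω then 4 else 1) ≤ 3 * Fintype.card Ω := by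
      have : (∑ ω : Ω, if bad x ω then 4 else 1)
          = Fintype.card Ω + 3 * (Finset.univ.filter (bad x)).card := by
        have : ∀ ω, (if bad x ω then 4 else 1) = 1 + 3 * (if bad x ω then 1 else 0) := by
          intro ω; split_ifs <;> rfl
        simp_rw [this, Finset.sum_add_distrib, ← Finset.mul_sum]
        simp
      have := h x
      omega
    calc _ = (Finset.univ.filter fun B : Fin t → Ω =>
        t ≤ 2 * (Finset.univ.filter fun i => bad x (B i)).card).card * 2 ^ t * 2 ^ t := by
          rw [mul_assoc, ← mul_pow]; norm_num
      _ ≤ (∑ ω : Ω, if bad x ω then 4 else 1) ^ t * 2 ^ t := by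
          rw [← h2]; gcongr
      _ = (2 * (∑ ω : Ω, if bad x ω then 4 else 1)) ^ t := by rw [mul_pow, mul_comm]
      _ ≤ (3 * Fintype.card Ω) ^ t := Nat.pow_le_pow_left h3 t
      _ = _ := mul_pow _ _ _
  have hcover : (Finset.univ : Finset (Fin t → Ω)) ⊆ Finset.univ.biUnion fun x : X =>
      Finset.univ.filter fun B : Fin t → Ω =>
        t ≤ 2 * (Finset.univ.filter fun i => bad x (B i)).card := by
    intro B _
    simpa using hcon B
  have hcard := (Finset.card_le_card hcover).trans Finset.card_biUnion_le
  rw [Finset.card_univ, Fintype.card_fun, Fintype.card_fin] at hcard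
  have hpos : 0 < Fintype.card Ω ^ t := pow_pos Fintype.card_pos t
  have : Fintype.card Ω ^ t * 4 ^ t ≤ Fintype.card X * 3 ^ t * Fintype.card Ω ^ t := by
    calc _ ≤ (∑ x : X, (Finset.univ.filter fun B : Fin t → Ω =>
        t ≤ 2 * (Finset.univ.filter fun i => bad x (B i)).card).card) * 4 ^ t := by gcongr
      _ ≤ ∑ x : X, 3 ^ t * Fintype.card Ω ^ t := by
        rw [Finset.sum_mul]; exact Finset.sum_le_sum fun x _ => hone x
      _ = _ := by simp [mul_assoc]
  have h4 := Nat.mul_lt_mul_of_pos_right ht hpos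
  rw [mul_comm (4 ^ t)] at h4
  omega

/-- For `w ≠ 0` the homomorphism `B ↦ B w` is surjective, so its fibres have equal size and `y + B
w` is uniform when `B` is. -/
theorem card_filter_add_mulVec {κ τ : Type*} [Fintype κ] [DecidableEq κ] [Fintype τ]
    [DecidableEq τ] (w : κ → ZMod 2) (hw : w ≠ 0) (y : τ → ZMod 2) (p : (τ → ZMod 2) → Prop)
    [DecidablePred p] :
    (Finset.univ.filter fun B : Matrix τ κ (ZMod 2) => p (y + B.mulVec w)).card
        * 2 ^ Fintype.card τ
      = Fintype.card (Matrix τ κ (ZMod 2)) * (Finset.univ.filter p).card := by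
  obtain ⟨i₀, hi₀⟩ := Function.ne_iff.mp hw
  let L : Matrix τ κ (ZMod 2) →+ (τ → ZMod 2) :=
    { toFun := fun B => B.mulVec w
      map_zero' := Matrix.zero_mulVec w
      map_add' := fun A B => Matrix.add_mulVec A B w }
  have hL : Function.Surjective L := by
    intro c
    refine ⟨Matrix.of fun j i => if i = i₀ then c j * (w i₀)⁻¹ else 0, ?_⟩
    ext j
    have hi₀' : w i₀ ≠ 0 := hi₀
    simp [L, Matrix.mulVec, dotProduct, hi₀']
  set c₀ := (Finset.univ.filter fun B => L B = 0).card with hc₀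
  have hfib : ∀ c, (Finset.univ.filter fun B => L B = c).card = c₀ := fun c =>
    AddMonoidHom.card_fiber_eq_of_mem_range L (hL c) (hL 0)
  have hcount : ∀ (q : (τ → ZMod 2) → Prop) [DecidablePred q],
      (Finset.univ.filter fun B : Matrix τ κ (ZMod 2) => q (L B)).card
        = (Finset.univ.filter q).card * c₀ := by
    intro q _
    rw [Finset.card_eq_sum_card_fiberwise (f := L) (t := Finset.univ.filter q)
      (fun B hB => by simpa using hB), ← smul_eq_mul, ← Finset.sum_const]
    refine Finset.sum_congr rfl fun c hc => ?_
    rw [← hfib c, Finset.filter_filter]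
    congr 1
    ext B
    simp only [Finset.mem_filter, Finset.mem_univ, true_and] at hc ⊢
    exact ⟨fun h => h.2, fun h => ⟨h ▸ hc, h⟩⟩
  have h1 := hcount fun c => p (y + c)
  have h2 := hcount fun _ => True
  have h3 : (Finset.univ.filter fun c => p (y + c)).card = (Finset.univ.filter p).card := by
    refine Finset.card_bij (fun c _ => y + c) (fun c hc => by simpa using hc)
      (fun a _ b _ h => add_left_cancel h) fun b hb => ⟨b - y, by simpa using hb, by simp⟩
  rw [h3] at h1
  simp only [Finset.filter_true, Finset.card_univ] at h2
  rw [h2, Fintype.card_fun, ZMod.card]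
  change (Finset.univ.filter fun B : Matrix τ κ (ZMod 2) => p (y + L B)).card * _ = _
  rw [h1]
  ring

end Majority

/-! ### Recovering a sparse function from its sums over graphs -/

section Directional

variable {κ τ : Type*} [Fintype κ] [DecidableEq κ] [Fintype τ] [DecidableEq τ]

/-- The sum of `F` along the graph of the linear map `B`, translated by `y`. -/
def graphSum (F : (κ → ZMod 2) → (τ → ZMod 2) → ZMod 2) (B : Matrix τ κ (ZMod 2))
    (y : τ → ZMod 2) : ZMod 2 :=
  ∑ u, F u (y + B.mulVec u)

/-- The translation by `y - B u` makes the graph pass through `(u, y)`. Over each `u' ≠ u` its point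
`y + B (u' - u)` is uniform, so a union bound over `u'` compares the support of `F` with `2 ^ card
τ`. -/
theorem card_graphSum_ne_le (F : (κ → ZMod 2) → (τ → ZMod 2) → ZMod 2)
    (hF : 6 * (∑ u, (Finset.univ.filter fun y => F u y ≠ 0).card) ≤ 2 ^ Fintype.card τ)
    (u : κ → ZMod 2) (y : τ → ZMod 2) :
    6 * (Finset.univ.filter fun B : Matrix τ κ (ZMod 2) =>
      graphSum F B (y - B.mulVec u) ≠ F u y).card ≤ Fintype.card (Matrix τ κ (ZMod 2)) := by
  have hsub : (Finset.univ.filter fun B : Matrix τ κ (ZMod 2) =>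
      graphSum F B (y - B.mulVec u) ≠ F u y) ⊆
      (Finset.univ.erase u).biUnion fun u' => Finset.univ.filter fun B : Matrix τ κ (ZMod 2) =>
        F u' (y + B.mulVec (u' - u)) ≠ 0 := by
    intro B hB
    simp only [Finset.mem_filter, Finset.mem_univ, true_and, Finset.mem_biUnion,
      Finset.mem_erase, and_true] at hB ⊢
    by_contra! hcon
    apply hB
    rw [graphSum, Finset.sum_eq_single u]
    · simp
    · intro u' _ hu'
      rw [← hcon u' hu', Matrix.mulVec_sub]
      congr 1
      abel
    · simp
  have h1 := (Finset.card_le_card hsub).trans Finset.card_biUnion_le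
  have h2 : (∑ u' ∈ Finset.univ.erase u, (Finset.univ.filter fun B : Matrix τ κ (ZMod 2) =>
        F u' (y + B.mulVec (u' - u)) ≠ 0).card) * 2 ^ Fintype.card τ
      ≤ Fintype.card (Matrix τ κ (ZMod 2)) * ∑ u, (Finset.univ.filter fun y => F u y ≠ 0).card := by
    rw [Finset.sum_mul, Finset.mul_sum]
    refine (Finset.sum_le_sum (g := fun u' => Fintype.card (Matrix τ κ (ZMod 2)) *
      (Finset.univ.filter fun y => F u' y ≠ 0).card) fun u' hu' => ?_).trans
      (Finset.sum_le_sum_of_subset (Finset.subset_univ _))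
    exact (card_filter_add_mulVec (u' - u) (sub_ne_zero.mpr (Finset.ne_of_mem_erase hu')) y
      fun c => F u' c ≠ 0).le
  have hpos : 0 < 2 ^ Fintype.card τ := by positivity
  refine Nat.le_of_mul_le_mul_right ?_ hpos
  calc _ ≤ 6 * ((∑ u' ∈ Finset.univ.erase u, (Finset.univ.filter
          fun B : Matrix τ κ (ZMod 2) => F u' (y + B.mulVec (u' - u)) ≠ 0).card)
          * 2 ^ Fintype.card τ) := by rw [mul_assoc]; gcongr
    _ ≤ 6 * (Fintype.card (Matrix τ κ (ZMod 2)) *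
        ∑ u, (Finset.univ.filter fun y => F u y ≠ 0).card) := by gcongr
    _ = Fintype.card (Matrix τ κ (ZMod 2)) *
        (6 * ∑ u, (Finset.univ.filter fun y => F u y ≠ 0).card) := by ring
    _ ≤ _ := by gcongr

/-- A function of small support is the majority vote of finitely many of its graph sums. -/
theorem exists_majority_graphSum (F : (κ → ZMod 2) → (τ → ZMod 2) → ZMod 2)
    (hF : 6 * (∑ u, (Finset.univ.filter fun y => F u y ≠ 0).card) ≤ 2 ^ Fintype.card τ)
    (t : ℕ) (ht : 2 ^ (Fintype.card κ + Fintype.card τ) * 3 ^ t < 4 ^ t) :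
    ∃ B : Fin t → Matrix τ κ (ZMod 2), ∀ u y, F u y =
      if t < 2 * (Finset.univ.filter fun i =>
        graphSum F (B i) (y - (B i).mulVec u) ≠ 0).card then 1 else 0 := by
  obtain ⟨B, hB⟩ := exists_tuple_forall_two_mul_card_lt
    (X := (κ → ZMod 2) × (τ → ZMod 2)) (Ω := Matrix τ κ (ZMod 2))
    (fun p B => graphSum F B (p.2 - B.mulVec p.1) ≠ F p.1 p.2)
    (fun p => card_graphSum_ne_le F hF p.1 p.2) t
    (by simpa [pow_add] using ht)
  refine ⟨B, fun u y => ?_⟩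
  have h := hB (u, y)
  simp only at h
  have hZ : ∀ a : ZMod 2, a = 0 ∨ a = 1 := by decide
  rcases hZ (F u y) with h0 | h1
  · rw [h0] at h ⊢
    rw [if_neg (by omega)]
  · rw [h1] at h ⊢
    have hs := Finset.card_filter_add_card_filter_not (s := Finset.univ)
      fun i => graphSum F (B i) (y - (B i).mulVec u) ≠ 1
    have : (Finset.univ.filter fun i => ¬ graphSum F (B i) (y - (B i).mulVec u) ≠ 1) =
        Finset.univ.filter fun i => graphSum F (B i) (y - (B i).mulVec u) ≠ 0 := by
      ext i
      have : ∀ a : ZMod 2, ¬ a ≠ 1 ↔ a ≠ 0 := by decide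
      simp [this]
    rw [this, Finset.card_univ, Fintype.card_fin] at hs
    rw [if_pos (by omega)]

end Directional

/-! ### Polynomial codes: partial summation and dimension -/

section PolyCode

open MvPolynomial

/-- The evaluation vectors on `𝔽₂^σ` of the polynomials of total degree at most `v`. -/
noncomputable def polyCode (σ : Type*) (v : ℕ) : Submodule (ZMod 2) ((σ → ZMod 2) → ZMod 2) :=
  (restrictTotalDegree σ (ZMod 2) v).map (evalₗ (ZMod 2) σ)

theorem reedMuller_eq_polyCode (n v : ℕ) : reedMuller n v = polyCode (Fin n) v := rfl

variable {σ κ τ : Type*}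

theorem mem_polyCode {v : ℕ} {f : (σ → ZMod 2) → ZMod 2} :
    f ∈ polyCode σ v ↔ ∃ P : MvPolynomial σ (ZMod 2), P.totalDegree ≤ v ∧ ∀ x, eval x P = f x := by
  simp only [polyCode, Submodule.mem_map, mem_restrictTotalDegree, funext_iff, evalₗ_apply]

theorem prod_pow_mem_polyCode [Fintype σ] {v : ℕ} (e : σ → ℕ) (he : ∑ i, e i ≤ v) :
    (fun x : σ → ZMod 2 => ∏ i, x i ^ e i) ∈ polyCode σ v := by
  refine mem_polyCode.mpr ⟨∏ i, X i ^ e i, ?_, fun x => by simp⟩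
  refine (totalDegree_finsetProd _ _).trans (le_trans (Finset.sum_le_sum fun i _ => ?_) he)
  rw [totalDegree_X_pow]

theorem comp_mem_polyCode {v : ℕ} {f : (σ → ZMod 2) → ZMod 2} (hf : f ∈ polyCode σ v)
    (φ : σ → MvPolynomial τ (ZMod 2)) (hφ : ∀ i, (φ i).totalDegree ≤ 1) :
    (fun x => f fun i => eval x (φ i)) ∈ polyCode τ v := by
  obtain ⟨P, hP, hPf⟩ := mem_polyCode.mp hf
  refine mem_polyCode.mpr ⟨bind₁ φ P, ?_, fun x => ?_⟩
  · rw [bind₁, aeval_def, eval₂_eq]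
    refine totalDegree_finsetSum_le fun s hs => ?_
    refine (totalDegree_mul _ _).trans ?_
    rw [algebraMap_eq, totalDegree_C, zero_add]
    refine (totalDegree_finsetProd _ _).trans ?_
    refine (Finset.sum_le_sum (g := fun i => s i) fun i _ => ?_).trans
      ((le_totalDegree hs).trans hP)
    refine (totalDegree_pow _ _).trans ?_
    simpa using Nat.mul_le_mul_left (s i) (hφ i)
  · rw [← hPf, ← aeval_eq_eval, ← aeval_eq_eval, aeval_bind₁]

variable [Fintype κ] [Fintype τ]

/-- Since `0 ^ 0 = 1`, the exponent `0` gives `1 + 1 = 0`: summing out a variable kills the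
monomials that omit it. -/
theorem sum_zmod_two_pow (e : ℕ) : ∑ a : ZMod 2, a ^ e = if e = 0 then 0 else 1 := by
  rw [show (Finset.univ : Finset (ZMod 2)) = {0, 1} from rfl, Finset.sum_pair (by decide), one_pow]
  split_ifs with h
  · subst h; decide
  · simp [h]

theorem sum_prod_sumElim_pow [DecidableEq κ] (e : κ ⊕ τ → ℕ) (y : τ → ZMod 2) :
    ∑ u : κ → ZMod 2, ∏ i, Sum.elim u y i ^ e i
      = (∏ i, if e (Sum.inl i) = 0 then 0 else 1) * ∏ j, y j ^ e (Sum.inr j) := by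
  simp_rw [Fintype.prod_sum_type, Sum.elim_inl, Sum.elim_inr, ← Finset.sum_mul,
    ← sum_zmod_two_pow]
  rw [Finset.prod_univ_sum, Fintype.piFinset_univ]

theorem exists_sum_sumElim_eq [DecidableEq κ] {v : ℕ} {f : (κ ⊕ τ → ZMod 2) → ZMod 2}
    (hf : f ∈ polyCode (κ ⊕ τ) v) : ∃ (S : Finset (κ ⊕ τ →₀ ℕ)) (c : (κ ⊕ τ →₀ ℕ) → ZMod 2),
      (∀ s ∈ S, ∑ i, s i ≤ v) ∧ ∀ y, ∑ u, f (Sum.elim u y) =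
        ∑ s ∈ S, c s * ((∏ i, if s (Sum.inl i) = 0 then 0 else 1) * ∏ j, y j ^ s (Sum.inr j)) := by
  obtain ⟨P, hP, hPf⟩ := mem_polyCode.mp hf
  refine ⟨P.support, fun s => P.coeff s, fun s hs => ?_, fun y => ?_⟩
  · refine le_trans (le_of_eq ?_) ((le_totalDegree hs).trans hP)
    rw [Finsupp.sum_fintype _ _ fun _ => rfl]
  · simp_rw [← hPf, eval_eq']
    rw [Finset.sum_comm]
    simp_rw [← Finset.mul_sum, sum_prod_sumElim_pow]

/-- A surviving monomial contains every `κ`-variable, and these use up `card κ` of its degree. -/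
theorem card_le_of_prod_ne_zero {e : κ ⊕ τ → ℕ}
    (h : (∏ i, if e (Sum.inl i) = 0 then (0 : ZMod 2) else 1) ≠ 0) :
    Fintype.card κ + ∑ j, e (Sum.inr j) ≤ ∑ i, e i := by
  rw [Fintype.sum_sum_type]
  gcongr
  rw [← Finset.card_univ, Finset.card_eq_sum_ones]
  refine Finset.sum_le_sum fun i _ => ?_
  have := Finset.prod_ne_zero_iff.mp h i (Finset.mem_univ i)
  exact Nat.one_le_iff_ne_zero.mpr fun h0 => this (if_pos h0)

/-- Summing over all values of `κ` variables lowers the degree by `card κ`. -/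
theorem sum_sumElim_mem_polyCode [DecidableEq κ] {v : ℕ} {f : (κ ⊕ τ → ZMod 2) → ZMod 2}
    (hf : f ∈ polyCode (κ ⊕ τ) v) :
    (fun y => ∑ u, f (Sum.elim u y)) ∈ polyCode τ (v - Fintype.card κ) := by
  obtain ⟨S, c, hS, h⟩ := exists_sum_sumElim_eq hf
  have : (fun y => ∑ u, f (Sum.elim u y)) = ∑ s ∈ S,
      (c s * ∏ i, if s (Sum.inl i) = 0 then 0 else 1) •
        fun y : τ → ZMod 2 => ∏ j, y j ^ s (Sum.inr j) := by
    ext y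
    simp [h, mul_assoc]
  rw [this]
  refine Submodule.sum_mem _ fun s hs => ?_
  by_cases h0 : (∏ i, if s (Sum.inl i) = 0 then (0 : ZMod 2) else 1) = 0
  · rw [h0, mul_zero, zero_smul]
    exact Submodule.zero_mem _
  · refine Submodule.smul_mem _ _ (prod_pow_mem_polyCode _ ?_)
    have := card_le_of_prod_ne_zero h0
    have := hS s hs
    omega

/-- Not contained in the degree drop: for `v < card κ` the truncated `v - card κ` is `0`, which
would still allow nonzero constants. -/
theorem sum_sumElim_eq_zero [DecidableEq κ] {v : ℕ} {f : (κ ⊕ τ → ZMod 2) → ZMod 2}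
    (hf : f ∈ polyCode (κ ⊕ τ) v) (hv : v < Fintype.card κ) (y : τ → ZMod 2) :
    ∑ u, f (Sum.elim u y) = 0 := by
  obtain ⟨S, c, hS, h⟩ := exists_sum_sumElim_eq hf
  rw [h]
  refine Finset.sum_eq_zero fun s hs => ?_
  by_cases h0 : (∏ i, if s (Sum.inl i) = 0 then (0 : ZMod 2) else 1) = 0
  · rw [h0, zero_mul, mul_zero]
  · have := card_le_of_prod_ne_zero h0
    have := hS s hs
    omega

/-- The monomials `∏ i ∈ s, x i` with `s.card ≤ v` span `polyCode σ v`. -/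
theorem polyCode_le_span [Fintype σ] [DecidableEq σ] (v : ℕ) :
    polyCode σ v ≤ Submodule.span (ZMod 2) ((fun s : Finset σ => fun x => ∏ i ∈ s, x i) ''
      {s | s.card ≤ v}) := by
  intro f hf
  obtain ⟨P, hP, hPf⟩ := mem_polyCode.mp hf
  have : f = ∑ s ∈ P.support, P.coeff s • fun x : σ → ZMod 2 => ∏ i ∈ s.support, x i := by
    ext x
    rw [← hPf, eval_eq, Finset.sum_apply]
    refine Finset.sum_congr rfl fun s _ => ?_
    rw [Pi.smul_apply, smul_eq_mul]
    congr 1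
    refine Finset.prod_congr rfl fun i hi => ?_
    have : ∀ a : ZMod 2, a = 0 ∨ a = 1 := by decide
    rcases this (x i) with h | h <;> simp [h, Finsupp.mem_support_iff.mp hi]
  rw [this]
  refine Submodule.sum_mem _ fun s hs => Submodule.smul_mem _ _ (Submodule.subset_span ⟨_, ?_, rfl⟩)
  refine le_trans ?_ ((le_totalDegree hs).trans hP)
  rw [Finset.card_eq_sum_ones, Finsupp.sum]
  exact Finset.sum_le_sum fun i hi => Nat.one_le_iff_ne_zero.mpr (Finsupp.mem_support_iff.mp hi)

theorem prod_mem_polyCode [Fintype σ] (s : Finset σ) {v : ℕ} (hs : s.card ≤ v) :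
    (fun x : σ → ZMod 2 => ∏ i ∈ s, x i) ∈ polyCode σ v := by
  refine mem_polyCode.mpr ⟨∏ i ∈ s, X i, ?_, fun x => by simp⟩
  refine (totalDegree_finsetProd _ _).trans (le_trans (le_of_eq ?_) hs)
  simp

theorem polyCode_eq_top [Fintype σ] : polyCode σ (Fintype.card σ) = ⊤ := by
  classical
  refine top_unique ?_
  rw [← map_restrict_dom_evalₗ (ZMod 2) σ, ZMod.card]
  rintro _ ⟨P, hP, rfl⟩
  refine ⟨P, ?_, rfl⟩
  rw [SetLike.mem_coe, mem_restrictTotalDegree, totalDegree]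
  refine Finset.sup_le fun s hs => ?_
  rw [SetLike.mem_coe, mem_restrictDegree] at hP
  rw [Finsupp.sum, Fintype.card_eq_sum_ones]
  refine (Finset.sum_le_sum fun i _ => hP s hs i).trans
    (Finset.sum_le_sum_of_subset (Finset.subset_univ _))

theorem card_filter_card_le [Fintype σ] (v : ℕ) :
    (Finset.univ.filter fun s : Finset σ => s.card ≤ v).card
      = ∑ i ∈ Finset.range (v + 1), (Fintype.card σ).choose i := by
  classical
  rw [Finset.card_eq_sum_card_fiberwise (f := Finset.card) (t := Finset.range (v + 1))
    fun s hs => by simpa [Nat.lt_succ_iff] using hs]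
  refine Finset.sum_congr rfl fun i hi => ?_
  rw [← Finset.card_univ, ← Finset.card_powersetCard]
  congr 1
  ext s
  simp only [Finset.mem_range] at hi
  simp only [Finset.mem_filter, Finset.mem_univ, true_and, Finset.mem_powersetCard,
    Finset.subset_univ]
  omega

theorem finrank_polyCode_le [Fintype σ] (v : ℕ) : Module.finrank (ZMod 2) (polyCode σ v)
    ≤ ∑ i ∈ Finset.range (v + 1), (Fintype.card σ).choose i := by
  classical
  refine (Submodule.finrank_mono (polyCode_le_span v)).trans ?_
  rw [← card_filter_card_le]
  have : (fun s : Finset σ => fun x : σ → ZMod 2 => ∏ i ∈ s, x i) '' {s | s.card ≤ v} =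
    ((Finset.univ.filter fun s : Finset σ => s.card ≤ v).image
      fun s : Finset σ => fun x : σ → ZMod 2 => ∏ i ∈ s, x i : Finset _) := by simp
  rw [this]
  exact (finrank_span_finset_le_card _).trans Finset.card_image_le

theorem card_polyCode_le [Fintype σ] (v : ℕ) : Nat.card (polyCode σ v)
    ≤ 2 ^ ∑ i ∈ Finset.range (v + 1), (Fintype.card σ).choose i := by
  rw [Module.natCard_eq_pow_finrank (K := ZMod 2), Nat.card_zmod]
  exact Nat.pow_le_pow_right (by norm_num) (finrank_polyCode_le v)

/-- The dimension of `polyCode σ v` is at least `2 ^ card σ` minus the number of sets of more than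
`v` elements; sets are counted through their complements. -/
theorem two_pow_le_finrank_polyCode_add [Fintype σ] (v : ℕ) : 2 ^ Fintype.card σ ≤
    Module.finrank (ZMod 2) (polyCode σ v)
      + ∑ i ∈ Finset.range (Fintype.card σ - v), (Fintype.card σ).choose i := by
  classical
  set T : Finset (Finset σ) := Finset.univ.filter fun s => v < s.card with hT
  set m : Finset σ → ((σ → ZMod 2) → ZMod 2) := fun s => fun x => ∏ i ∈ s, x i with hm
  have htop : (⊤ : Submodule (ZMod 2) ((σ → ZMod 2) → ZMod 2)) ≤
      polyCode σ v ⊔ Submodule.span (ZMod 2) (T.image m : Finset _) := by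
    rw [← polyCode_eq_top]
    refine (polyCode_le_span _).trans (Submodule.span_le.mpr ?_)
    rintro _ ⟨s, -, rfl⟩
    by_cases hs : s.card ≤ v
    · exact Submodule.mem_sup_left (prod_mem_polyCode s hs)
    · refine Submodule.mem_sup_right (Submodule.subset_span ?_)
      exact Finset.mem_coe.mpr (Finset.mem_image_of_mem m (by simpa [hT] using hs))
  have h1 := Submodule.finrank_mono htop
  rw [finrank_top, Module.finrank_fintype_fun_eq_card, Fintype.card_fun, ZMod.card] at h1
  have h2 := Submodule.finrank_add_le_finrank_add_finrank (polyCode σ v)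
    (Submodule.span (ZMod 2) (T.image m : Finset ((σ → ZMod 2) → ZMod 2)))
  have h3 := (finrank_span_finset_le_card (R := ZMod 2) (T.image m)).trans Finset.card_image_le
  rw [Set.finrank] at h3
  have h4 : T.card ≤ ∑ i ∈ Finset.range (Fintype.card σ - v), (Fintype.card σ).choose i := by
    rcases Nat.lt_or_ge v (Fintype.card σ) with hv | hv
    · obtain ⟨w, hw⟩ : ∃ w, Fintype.card σ - v = w + 1 := ⟨Fintype.card σ - v - 1, by omega⟩
      rw [hw, ← card_filter_card_le]
      refine Finset.card_le_card_of_injOn compl (fun s hs => ?_) compl_injective.injOn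
      simp only [hT, Finset.coe_filter, Finset.mem_univ, true_and, Set.mem_ofPred_eq,
        Finset.card_compl] at hs ⊢
      omega
    · have : T = ∅ := by
        rw [hT, Finset.filter_eq_empty_iff]
        intro s _
        have := Finset.card_le_univ s
        omega
      simp [this]
  omega

end PolyCode

/-! ### Minimum weight and number of light codewords -/

section Counting

open MvPolynomial

variable {σ κ τ : Type*}

/-- A function on `𝔽₂^σ` as a function of two groups of variables. -/
def curryVars (e : κ ⊕ τ ≃ σ) (f : (σ → ZMod 2) → ZMod 2) (u : κ → ZMod 2) (y : τ → ZMod 2) :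
    ZMod 2 :=
  f fun i => Sum.elim u y (e.symm i)

theorem curryVars_apply (e : κ ⊕ τ ≃ σ) (f : (σ → ZMod 2) → ZMod 2) (x : σ → ZMod 2) :
    f x = curryVars e f (fun a => x (e (Sum.inl a))) (fun b => x (e (Sum.inr b))) := by
  rw [curryVars]
  congr 1
  ext i
  obtain ⟨j, rfl⟩ := e.surjective i
  cases j <;> simp

variable [Fintype κ] [DecidableEq κ] [Fintype τ]

/-- The shear `(u, y) ↦ (u, y + B u)` is an affine substitution, so it keeps the degree at most `v`;
the graph sum is then a sum over all values of the `κ`-variables. -/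
theorem graphSum_curryVars_mem_and_eq_zero (e : κ ⊕ τ ≃ σ) {v : ℕ} {f : (σ → ZMod 2) → ZMod 2}
    (hf : f ∈ polyCode σ v) (B : Matrix τ κ (ZMod 2)) :
    graphSum (curryVars e f) B ∈ polyCode τ (v - Fintype.card κ) ∧
      (v < Fintype.card κ → graphSum (curryVars e f) B = 0) := by
  let φ : σ → MvPolynomial (κ ⊕ τ) (ZMod 2) := fun i => Sum.elim (fun a => X (Sum.inl a))
    (fun b => X (Sum.inr b) + ∑ a, C (B b a) * X (Sum.inl a)) (e.symm i)
  have hφ : ∀ i, (φ i).totalDegree ≤ 1 := by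
    intro i
    obtain ⟨j, rfl⟩ := e.surjective i
    rcases j with a | b
    · simp [φ]
    · simp only [φ, Equiv.symm_apply_apply, Sum.elim_inr]
      refine (totalDegree_add _ _).trans (max_le (by simp) (totalDegree_finsetSum_le fun a _ => ?_))
      refine (totalDegree_mul _ _).trans ?_
      simp
  have hg := comp_mem_polyCode hf φ hφ
  have heq : ∀ y, graphSum (curryVars e f) B y = ∑ u, f fun i => eval (Sum.elim u y) (φ i) := by
    intro y
    refine Finset.sum_congr rfl fun u _ => ?_
    rw [curryVars]
    congr 1
    ext i
    obtain ⟨j, rfl⟩ := e.surjective i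
    rcases j with a | b
    · simp [φ]
    · simp [φ, Matrix.mulVec, dotProduct]
  constructor
  · have := sum_sumElim_mem_polyCode hg
    rwa [← funext heq] at this
  · intro hv
    ext y
    rw [heq, sum_sumElim_eq_zero hg hv]
    rfl

variable [Fintype σ] [DecidableEq σ] [DecidableEq τ]

theorem sum_card_curryVars_ne_zero (e : κ ⊕ τ ≃ σ) (f : (σ → ZMod 2) → ZMod 2) :
    ∑ u, (Finset.univ.filter fun y => curryVars e f u y ≠ 0).card = hammingNorm f := by
  rw [hammingNorm, Finset.card_eq_sum_card_fiberwise
    (f := fun (x : σ → ZMod 2) (a : κ) => x (e (Sum.inl a))) (t := Finset.univ) (fun _ _ => by simp)]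
  refine Finset.sum_congr rfl fun u _ => ?_
  refine Finset.card_bij (fun y _ => fun i => Sum.elim u y (e.symm i)) ?_ ?_ ?_
  · intro y hy
    simp only [Finset.mem_filter, Finset.mem_univ, true_and] at hy ⊢
    exact ⟨hy, by ext; simp⟩
  · intro y _ y' _ h
    ext b
    simpa using congrFun h (e (Sum.inr b))
  · intro x hx
    simp only [Finset.mem_filter, Finset.mem_univ, true_and] at hx
    refine ⟨fun b => x (e (Sum.inr b)), ?_, ?_⟩
    · simp only [Finset.mem_filter, Finset.mem_univ, true_and]
      rw [← hx.2, ← curryVars_apply]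
      exact hx.1
    · ext i
      obtain ⟨j, rfl⟩ := e.surjective i
      cases j <;> simp [← hx.2]

/-- A word of `polyCode σ v` of weight at most `2 ^ (card σ - k) / 6` with `v < k` vanishes. -/
theorem eq_zero_of_hammingNorm_le (e : κ ⊕ τ ≃ σ) {v : ℕ} {f : (σ → ZMod 2) → ZMod 2}
    (hf : f ∈ polyCode σ v) (hv : v < Fintype.card κ)
    (hw : 6 * hammingNorm f ≤ 2 ^ Fintype.card τ) (t : ℕ)
    (ht : 2 ^ (Fintype.card κ + Fintype.card τ) * 3 ^ t < 4 ^ t) : f = 0 := by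
  obtain ⟨B, hB⟩ := exists_majority_graphSum (curryVars e f)
    (by rwa [sum_card_curryVars_ne_zero]) t ht
  ext x
  rw [curryVars_apply e f, hB]
  simp [(graphSum_curryVars_mem_and_eq_zero e hf _).2 hv]

/-- The number of words of `polyCode σ v` of weight at most `2 ^ (card σ - k) / 6`. -/
theorem card_hammingNorm_le (e : κ ⊕ τ ≃ σ) (v t : ℕ)
    (ht : 2 ^ (Fintype.card κ + Fintype.card τ) * 3 ^ t < 4 ^ t)
    (s : Finset ((σ → ZMod 2) → ZMod 2))
    (hs : ∀ f ∈ s, f ∈ polyCode σ v ∧ 6 * hammingNorm f ≤ 2 ^ Fintype.card τ) :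
    s.card ≤ 2 ^ (t * (Fintype.card τ * Fintype.card κ +
      ∑ i ∈ Finset.range (v - Fintype.card κ + 1), (Fintype.card τ).choose i)) := by
  classical
  -- The decoding map: `t` pairs of a matrix and a low-degree word determine a function by majority.
  -- Every `f ∈ s` is in its image.
  let vote : (Fin t → Matrix τ κ (ZMod 2) × polyCode τ (v - Fintype.card κ)) →
      (σ → ZMod 2) → ZMod 2 := fun d x =>
    if t < 2 * (Finset.univ.filter fun i => (d i).2.1 ((fun b => x (e (Sum.inr b))) -
      (d i).1.mulVec fun a => x (e (Sum.inl a))) ≠ 0).card then 1 else 0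
  have hsub : s ⊆ Finset.univ.image vote := by
    intro f hfs
    obtain ⟨hf, hw⟩ := hs f hfs
    obtain ⟨B, hB⟩ := exists_majority_graphSum (curryVars e f)
      (by rwa [sum_card_curryVars_ne_zero]) t ht
    refine Finset.mem_image.mpr ⟨fun i => (B i, ⟨_,
      (graphSum_curryVars_mem_and_eq_zero e hf (B i)).1⟩), Finset.mem_univ _, ?_⟩
    ext x
    rw [curryVars_apply e f, hB]
  refine (Finset.card_le_card hsub).trans (Finset.card_image_le.trans ?_)
  rw [Finset.card_univ, Fintype.card_fun, Fintype.card_prod, Fintype.card_fin, mul_comm t, pow_mul,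
    pow_add]
  refine Nat.pow_le_pow_left (Nat.mul_le_mul (le_of_eq ?_) ?_) t
  · change Fintype.card (τ → κ → ZMod 2) = _
    rw [Fintype.card_fun, Fintype.card_fun, ZMod.card, ← pow_mul, mul_comm]
  · rw [← Nat.card_eq_fintype_card]
    exact card_polyCode_le _

end Counting

/-! ### Pointwise comparison of block decisions with list decoding -/

section ListDecoding

/-- The error of a maximum-likelihood decision `d` is bounded by that of listing the words within
distance `ρ` of `b`, plus that of deciding between pairs of words at distance at most `2 * ρ`. -/
theorem sum_ite_likelihood_le {ι : Type*} [Fintype ι] (S : Finset (ι → ZMod 2))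
    (L : (ι → ZMod 2) → ℝ) (hL : ∀ x, 0 ≤ L x) (b d : ι → ZMod 2) (hd : d ∈ S)
    (hmax : ∀ x ∈ S, L x ≤ L d) (ρ : ℕ) :
    ∑ x ∈ S, (if d ≠ x then L x else 0) ≤
      ∑ x ∈ S, (hammingDist b x : ℝ) / (ρ + 1) * L x +
      ∑ x ∈ S, ∑ x' ∈ S with x ≠ x' ∧ hammingDist x x' ≤ 2 * ρ, √(L x * L x') := by
  classical
  have hρ : (0 : ℝ) < ρ + 1 := by positivity
  have hfar : ∀ x, ρ < hammingDist b x → L x ≤ (hammingDist b x : ℝ) / (ρ + 1) * L x := by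
    intro x hx
    refine le_mul_of_one_le_left (hL x) ((one_le_div hρ).mpr ?_)
    exact_mod_cast hx
  have hdist : ∀ x, 0 ≤ (hammingDist b x : ℝ) / (ρ + 1) * L x := fun x =>
    mul_nonneg (by positivity) (hL x)
  have hpair : ∀ x, 0 ≤ ∑ x' ∈ S with x ≠ x' ∧ hammingDist x x' ≤ 2 * ρ, √(L x * L x') :=
    fun x => Finset.sum_nonneg fun _ _ => Real.sqrt_nonneg _
  have hlhs : ∑ x ∈ S, (if d ≠ x then L x else 0) = ∑ x ∈ S, L x - L d := by
    rw [← Finset.sum_erase_eq_sub hd, ← Finset.sum_filter]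
    congr 1
    ext x
    simp only [Finset.mem_filter, Finset.mem_erase, ne_comm, and_comm]
  rw [hlhs]
  rcases (S.filter fun x => hammingDist b x ≤ ρ).eq_empty_or_nonempty with hempty | hne
  -- With an empty list, every word is far from `b` and the Markov term alone suffices.
  · have h1 : ∑ x ∈ S, L x ≤ ∑ x ∈ S, (hammingDist b x : ℝ) / (ρ + 1) * L x := by
      refine Finset.sum_le_sum fun x hx => hfar x ?_
      have := Finset.filter_eq_empty_iff.mp hempty hx
      omega
    have h2 := Finset.sum_nonneg fun x (_ : x ∈ S) => hpair x
    linarith [hL d]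
  -- Here `m` is the list decoder's choice. Its error `∑ L - L m` dominates that of `d`, and a
  -- listed `x ≠ m` satisfies `L x ≤ √(L x * L m)`.
  · obtain ⟨m, hm, hmmax⟩ := Finset.exists_max_image _ L hne
    rw [Finset.mem_filter] at hm
    have h1 : ∑ x ∈ S, L x - L m ≤ ∑ x ∈ S, ((hammingDist b x : ℝ) / (ρ + 1) * L x +
        ∑ x' ∈ S with x ≠ x' ∧ hammingDist x x' ≤ 2 * ρ, √(L x * L x')) := by
      rw [← Finset.sum_erase_eq_sub hm.1]
      refine (Finset.sum_le_sum fun x hx => ?_).trans (Finset.sum_le_sum_of_subset_of_nonneg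
        (Finset.erase_subset m S) fun x _ _ => add_nonneg (hdist x) (hpair x))
      rw [Finset.mem_erase] at hx
      rcases Nat.lt_or_ge ρ (hammingDist b x) with hbx | hbx
      · linarith [hfar x hbx, hpair x]
      · have h2 : L x ≤ √(L x * L m) := by
          refine Real.le_sqrt_of_sq_le ?_
          rw [sq]
          exact mul_le_mul_of_nonneg_left (hmmax x (Finset.mem_filter.mpr ⟨hx.2, hbx⟩)) (hL x)
        have h3 : √(L x * L m) ≤ ∑ x' ∈ S with x ≠ x' ∧ hammingDist x x' ≤ 2 * ρ,
            √(L x * L x') := by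
          refine Finset.single_le_sum (f := fun x' => √(L x * L x'))
            (fun _ _ => Real.sqrt_nonneg _) (Finset.mem_filter.mpr ⟨hm.1, hx.1, ?_⟩)
          have := hammingDist_triangle_left x m b
          omega
        linarith [hdist x]
    rw [Finset.sum_add_distrib] at h1
    linarith [hmax m hm.1]

end ListDecoding

/-! ### Block densities, Bhattacharyya integrals and the block error bound -/

namespace BMSChannel

variable {Y : Type*} [MeasurableSpace Y] (W : BMSChannel Y)

instance isFiniteMeasure_ref : IsFiniteMeasure W.ref := by
  unfold ref; infer_instance

theorem law_absolutelyContinuous_ref (b : ZMod 2) : W.law b ≪ W.ref := by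
  have : b = 0 ∨ b = 1 := by revert b; decide
  rcases this with rfl | rfl
  · exact (Measure.le_add_right le_rfl).absolutelyContinuous
  · exact (Measure.le_add_left le_rfl).absolutelyContinuous

theorem measurable_density (b : ZMod 2) : Measurable (W.density b) :=
  (Measure.measurable_rnDeriv _ _).ennreal_toReal

theorem density_nonneg (b : ZMod 2) (y : Y) : 0 ≤ W.density b y := ENNReal.toReal_nonneg

theorem integrable_density (b : ZMod 2) : Integrable (W.density b) W.ref :=
  Measure.integrable_toReal_rnDeriv

theorem setIntegral_density (b : ZMod 2) (s : Set Y) :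
    ∫ y in s, W.density b y ∂W.ref = (W.law b).real s :=
  Measure.setIntegral_toReal_rnDeriv (W.law_absolutelyContinuous_ref b) s

theorem integral_sqrt_density_mul (a b : ZMod 2) :
    ∫ y, √(W.density a y * W.density b y) ∂W.ref = if a = b then 1 else W.bhattacharyya := by
  split_ifs with h
  · subst h
    simp_rw [Real.sqrt_mul_self (W.density_nonneg a _)]
    rw [← setIntegral_univ, setIntegral_density, probReal_univ]
  · have : (a = 0 ∧ b = 1) ∨ (a = 1 ∧ b = 0) := by revert a b; decide
    rcases this with ⟨rfl, rfl⟩ | ⟨rfl, rfl⟩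
    · rfl
    · simp_rw [mul_comm (W.density 1 _)]
      rfl

theorem integrable_sqrt_density_mul (a b : ZMod 2) :
    Integrable (fun y => √(W.density a y * W.density b y)) W.ref := by
  refine ((W.integrable_density a).add (W.integrable_density b)).mono'
    ((W.measurable_density a).mul (W.measurable_density b)).sqrt.aestronglyMeasurable
    (Eventually.of_forall fun y => ?_)
  rw [Real.norm_of_nonneg (Real.sqrt_nonneg _)]
  have ha := W.density_nonneg a y
  have hb := W.density_nonneg b y
  refine (Real.sqrt_le_left (add_nonneg ha hb)).mpr ?_
  nlinarith

variable {ι : Type*} [Fintype ι]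

/-- The reference measure on output blocks. -/
noncomputable def blockRef (ι : Type*) [Fintype ι] : Measure (ι → Y) := Measure.pi fun _ => W.ref

theorem likelihood_nonneg (x : ι → ZMod 2) (y : ι → Y) : 0 ≤ W.likelihood x y :=
  Finset.prod_nonneg fun _ _ => W.density_nonneg _ _

theorem measurable_likelihood (x : ι → ZMod 2) : Measurable (W.likelihood x) :=
  Finset.measurable_prod _ fun i _ => (W.measurable_density (x i)).comp (measurable_pi_apply i)

theorem integrable_likelihood (x : ι → ZMod 2) : Integrable (W.likelihood x) (W.blockRef ι) :=
  Integrable.fintype_prod fun i => W.integrable_density (x i)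

theorem blockLaw_eq_withDensity (x : ι → ZMod 2) : W.blockLaw x =
    (W.blockRef ι).withDensity fun y => ENNReal.ofReal (W.likelihood x y) := by
  refine Measure.pi_eq fun s hs => ?_
  have hms : MeasurableSet (Set.univ.pi s) := MeasurableSet.univ_pi hs
  rw [withDensity_apply _ hms, ← ofReal_integral_eq_lintegral_ofReal
    (W.integrable_likelihood x).integrableOn
    (Eventually.of_forall fun y => W.likelihood_nonneg x y)]
  have h1 : ∫ y in Set.univ.pi s, W.likelihood x y ∂W.blockRef ι =
      ∏ i, (W.law (x i)).real (s i) := by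
    simp_rw [← W.setIntegral_density]
    rw [blockRef, Measure.restrict_pi_pi]
    exact integral_fintype_prod_eq_prod (μ := fun i => W.ref.restrict (s i))
      (fun i y => W.density (x i) y)
  rw [h1, ENNReal.ofReal_prod_of_nonneg fun _ _ => measureReal_nonneg]
  simp

theorem blockLaw_real_apply (x : ι → ZMod 2) {s : Set (ι → Y)} (hs : MeasurableSet s) :
    (W.blockLaw x).real s = ∫ y, s.indicator (W.likelihood x) y ∂W.blockRef ι := by
  rw [integral_indicator hs, measureReal_def, blockLaw_eq_withDensity, withDensity_apply _ hs,
    integral_eq_lintegral_of_nonneg_ae (Eventually.of_forall fun y => W.likelihood_nonneg x y)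
    (W.measurable_likelihood x).aestronglyMeasurable]

theorem ae_blockLaw_iff (x : ι → ZMod 2) {p : (ι → Y) → Prop} :
    (∀ᵐ y ∂W.blockLaw x, p y) ↔ ∀ᵐ y ∂W.blockRef ι, W.likelihood x y ≠ 0 → p y := by
  rw [blockLaw_eq_withDensity, ae_withDensity_iff (W.measurable_likelihood x).ennreal_ofReal]
  refine eventually_congr (Eventually.of_forall fun y => ?_)
  rw [Ne, ENNReal.ofReal_eq_zero, (W.likelihood_nonneg x y).ge_iff_eq', ← Ne]

theorem sqrt_likelihood_mul (x x' : ι → ZMod 2) (y : ι → Y) :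
    √(W.likelihood x y * W.likelihood x' y) =
      ∏ i, √(W.density (x i) (y i) * W.density (x' i) (y i)) := by
  rw [likelihood, likelihood, ← Finset.prod_mul_distrib, Real.sqrt_prod]
  exact fun i _ => mul_nonneg (W.density_nonneg _ _) (W.density_nonneg _ _)

theorem integrable_sqrt_likelihood_mul (x x' : ι → ZMod 2) :
    Integrable (fun y => √(W.likelihood x y * W.likelihood x' y)) (W.blockRef ι) := by
  simp_rw [sqrt_likelihood_mul]
  exact Integrable.fintype_prod (f := fun i a => √(W.density (x i) a * W.density (x' i) a))
    fun i => W.integrable_sqrt_density_mul (x i) (x' i)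

/-- The integral factors over coordinates: agreements contribute `1`, disagreements the
Bhattacharyya parameter. -/
theorem integral_sqrt_likelihood_mul (x x' : ι → ZMod 2) :
    ∫ y, √(W.likelihood x y * W.likelihood x' y) ∂W.blockRef ι
      = W.bhattacharyya ^ hammingDist x x' := by
  simp_rw [sqrt_likelihood_mul]
  rw [blockRef, integral_fintype_prod_eq_prod
    (f := fun i a => √(W.density (x i) a * W.density (x' i) a))]
  simp_rw [integral_sqrt_density_mul, hammingDist]
  rw [Finset.prod_ite]
  simp

variable (C : Submodule (ZMod 2) (ι → ZMod 2))

theorem mem_codewords {C : Submodule (ZMod 2) (ι → ZMod 2)} {x : ι → ZMod 2} :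
    x ∈ codewords C ↔ x ∈ C := by simp [codewords]

variable {C}

/-- Optimality is given almost everywhere for the law of each codeword, hence for `blockRef` where
that codeword has nonzero likelihood. To bound the likelihood of `x`, the law of `x` itself
suffices, the bound being trivial where the likelihood vanishes. -/
theorem ae_likelihood_le {d : (ι → Y) → (ι → ZMod 2)} (hd : W.IsBlockMAP C d) :
    ∀ᵐ y ∂W.blockRef ι, ∀ x ∈ C, W.likelihood x y ≤ W.likelihood (d y) y := by
  have h : ∀ᵐ y ∂W.blockRef ι, ∀ c ∈ codewords C, W.likelihood c y ≠ 0 →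
      ∀ x ∈ C, W.posterior C x y ≤ W.posterior C (d y) y := by
    rw [Finset.eventually_all]
    exact fun c hc => (W.ae_blockLaw_iff c).mp (hd.isMax c (mem_codewords.mp hc))
  filter_upwards [h] with y hy x hx
  by_cases h0 : W.likelihood x y = 0
  · rw [h0]; exact W.likelihood_nonneg _ _
  · have hle := hy x (mem_codewords.mpr hx) h0 x hx
    have hpos : 0 < ∑ x' ∈ codewords C, W.likelihood x' y :=
      Finset.sum_pos' (fun _ _ => W.likelihood_nonneg _ _) ⟨x, mem_codewords.mpr hx,
        lt_of_le_of_ne (W.likelihood_nonneg _ _) (Ne.symm h0)⟩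
    exact (div_le_div_iff_of_pos_right hpos).mp hle

/-- By linearity, translation by `-x` carries the distances from `x` to the weights of codewords. -/
theorem sum_sum_pow_hammingDist (z : ℝ) (r : ℕ) :
    ∑ x ∈ codewords C, ∑ x' ∈ codewords C with x ≠ x' ∧ hammingDist x x' ≤ r,
      z ^ hammingDist x x' = (codewords C).card *
      ∑ c ∈ codewords C with c ≠ 0 ∧ hammingNorm c ≤ r, z ^ hammingNorm c := by
  rw [← nsmul_eq_mul, ← Finset.sum_const]
  refine Finset.sum_congr rfl fun x hx => ?_
  have hxC := mem_codewords.mp hx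
  refine Finset.sum_bij' (fun x' _ => -x + x') (fun c _ => x + c) ?_ ?_ ?_ ?_ ?_
  · intro x' hx'
    simp only [Finset.mem_filter, mem_codewords, hammingDist_eq_hammingNorm] at hx' ⊢
    refine ⟨C.add_mem (C.neg_mem hxC) hx'.1, fun h => hx'.2.1 ?_, hx'.2.2⟩
    exact (neg_add_eq_zero.mp h)
  · intro c hc
    simp only [Finset.mem_filter, mem_codewords, hammingDist_eq_hammingNorm] at hc ⊢
    refine ⟨C.add_mem hxC hc.1, fun h => hc.2.1 (by simpa using h), ?_⟩
    rw [neg_add_cancel_left]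
    exact hc.2.2
  · intro _ _; simp
  · intro _ _; simp
  · intro x' _; rw [hammingDist_eq_hammingNorm]

/-- The block error of the block-MAP decoder in terms of the bit error of any measurable bitwise
decision and of the number of codewords of small weight. -/
theorem blockError_le {d : (ι → Y) → (ι → ZMod 2)} (hd : W.IsBlockMAP C d)
    {b : ι → (ι → Y) → ZMod 2} (hb : ∀ i a, MeasurableSet {y | b i y = a}) (ρ : ℕ) :
    W.blockError C d ≤ Fintype.card ι / (ρ + 1) * W.bitError C b +
      ∑ c ∈ codewords C with c ≠ 0 ∧ hammingNorm c ≤ 2 * ρ, W.bhattacharyya ^ hammingNorm c := by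
  classical
  have hcard : (0 : ℝ) < (codewords C).card := by
    exact_mod_cast Finset.card_pos.mpr ⟨0, mem_codewords.mpr C.zero_mem⟩
  have hmd : ∀ x, MeasurableSet {y | d y ≠ x} := fun x => (hd.measurable x).compl
  have hmb : ∀ i a, MeasurableSet {y | b i y ≠ a} := fun i a => (hb i a).compl
  have hintd : ∀ x, Integrable ({y | d y ≠ x}.indicator (W.likelihood x)) (W.blockRef ι) :=
    fun x => (W.integrable_likelihood x).indicator (hmd x)
  have hintb : ∀ (x : ι → ZMod 2) i,
      Integrable ({y | b i y ≠ x i}.indicator (W.likelihood x)) (W.blockRef ι) :=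
    fun x i => (W.integrable_likelihood x).indicator (hmb i (x i))
  have key : ∑ x ∈ codewords C, (W.blockLaw x).real {y | d y ≠ x} ≤
      (ρ + 1 : ℝ)⁻¹ * ∑ x ∈ codewords C, ∑ i, (W.blockLaw x).real {y | b i y ≠ x i} +
      ∑ x ∈ codewords C, ∑ x' ∈ codewords C with x ≠ x' ∧ hammingDist x x' ≤ 2 * ρ,
        W.bhattacharyya ^ hammingDist x x' := by
    simp_rw [← W.integral_sqrt_likelihood_mul, W.blockLaw_real_apply _ (hmd _),
      W.blockLaw_real_apply _ (hmb _ _)]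
    have e1 : ∑ x ∈ codewords C,
        ∫ y, {y | d y ≠ x}.indicator (W.likelihood x) y ∂W.blockRef ι =
        ∫ y, ∑ x ∈ codewords C, {y | d y ≠ x}.indicator (W.likelihood x) y ∂W.blockRef ι :=
      (integral_finsetSum _ fun x _ => hintd x).symm
    have i2 : Integrable (fun y => (ρ + 1 : ℝ)⁻¹ * ∑ x ∈ codewords C, ∑ i,
        {y | b i y ≠ x i}.indicator (W.likelihood x) y) (W.blockRef ι) :=
      (integrable_finsetSum _ fun x _ => integrable_finsetSum _ fun i _ => hintb x i).const_mul _
    have e2 : (ρ + 1 : ℝ)⁻¹ * ∑ x ∈ codewords C, ∑ i,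
        ∫ y, {y | b i y ≠ x i}.indicator (W.likelihood x) y ∂W.blockRef ι =
        ∫ y, (ρ + 1 : ℝ)⁻¹ * ∑ x ∈ codewords C, ∑ i,
          {y | b i y ≠ x i}.indicator (W.likelihood x) y ∂W.blockRef ι := by
      rw [integral_const_mul, integral_finsetSum _ fun x _ =>
        integrable_finsetSum _ fun i _ => hintb x i]
      congr 1
      refine Finset.sum_congr rfl fun x _ => ?_
      rw [integral_finsetSum _ fun i _ => hintb x i]
    have i3 : Integrable (fun y => ∑ x ∈ codewords C, ∑ x' ∈ codewords C
        with x ≠ x' ∧ hammingDist x x' ≤ 2 * ρ, √(W.likelihood x y * W.likelihood x' y))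
        (W.blockRef ι) :=
      integrable_finsetSum _ fun x _ => integrable_finsetSum _ fun x' _ =>
        W.integrable_sqrt_likelihood_mul x x'
    have e3 : ∑ x ∈ codewords C, ∑ x' ∈ codewords C with x ≠ x' ∧ hammingDist x x' ≤ 2 * ρ,
        ∫ y, √(W.likelihood x y * W.likelihood x' y) ∂W.blockRef ι =
        ∫ y, ∑ x ∈ codewords C, ∑ x' ∈ codewords C with x ≠ x' ∧ hammingDist x x' ≤ 2 * ρ,
          √(W.likelihood x y * W.likelihood x' y) ∂W.blockRef ι := by
      rw [integral_finsetSum _ fun x _ => integrable_finsetSum _ fun x' _ =>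
        W.integrable_sqrt_likelihood_mul x x']
      refine Finset.sum_congr rfl fun x _ => ?_
      rw [integral_finsetSum _ fun x' _ => W.integrable_sqrt_likelihood_mul x x']
    rw [e1, e2, e3, ← integral_add i2 i3]
    refine integral_mono_ae (integrable_finsetSum _ fun x _ => hintd x) (i2.add i3) ?_
    filter_upwards [W.ae_likelihood_le hd] with y hy
    have h := sum_ite_likelihood_le (codewords C) (fun x => W.likelihood x y)
      (fun x => W.likelihood_nonneg x y) (fun i => b i y) (d y) (mem_codewords.mpr (hd.mem y))
      (fun x hx => hy x (mem_codewords.mp hx)) ρ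
    have hl : ∑ x ∈ codewords C, {y | d y ≠ x}.indicator (W.likelihood x) y =
        ∑ x ∈ codewords C, (if d y ≠ x then W.likelihood x y else 0) := by
      refine Finset.sum_congr rfl fun x _ => ?_
      rw [Set.indicator_apply]
      rfl
    have hr : (ρ + 1 : ℝ)⁻¹ * ∑ x ∈ codewords C, ∑ i,
        {y | b i y ≠ x i}.indicator (W.likelihood x) y =
        ∑ x ∈ codewords C, (hammingDist (fun i => b i y) x : ℝ) / (ρ + 1) * W.likelihood x y := by
      rw [Finset.mul_sum]
      refine Finset.sum_congr rfl fun x _ => ?_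
      have : ∑ i, {y | b i y ≠ x i}.indicator (W.likelihood x) y =
          hammingDist (fun i => b i y) x * W.likelihood x y := by
        rw [hammingDist, ← nsmul_eq_mul, ← Finset.sum_const, Finset.sum_filter]
        refine Finset.sum_congr rfl fun i _ => ?_
        rw [Set.indicator_apply]
        rfl
      rw [this]
      ring
    rw [hl, hr]
    exact h
  rw [sum_sum_pow_hammingDist, Finset.sum_comm] at key
  rw [blockError, div_le_iff₀ hcard]
  refine key.trans (le_of_eq ?_)
  rw [add_mul, mul_comm ((codewords C).card : ℝ)]
  congr 1
  rw [bitError]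
  rcases isEmpty_or_nonempty ι with hι | hι
  · simp
  · have : (0 : ℝ) < Fintype.card ι := by exact_mod_cast Fintype.card_pos
    rw [← Finset.sum_div]
    field_simp

end BMSChannel

/-! ### Binomial tails, the degree forced by the rate, and the union bound -/

section Asymptotics

/-- The Hoeffding bound for the lower tail of the binomial coefficients. -/
theorem sum_range_choose_le (m s : ℕ) (η : ℝ) (hη : 0 ≤ η) (hs : (s : ℝ) ≤ (1 / 2 - η) * m) :
    ((∑ i ∈ Finset.range (s + 1), m.choose i : ℕ) : ℝ) ≤
      2 ^ m * Real.exp (-(2 * η ^ 2 * m)) := by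
  -- Exponential tilting: each term with `i ≤ s` is multiplied by `exp (4 * η * (s - i)) ≥ 1`. The
  -- parameter `4 * η` yields the exponent `2 * η ^ 2` after `cosh x ≤ exp (x ^ 2 / 2)` at `x = 2 *
  -- η`.
  have h1 : ((∑ i ∈ Finset.range (s + 1), m.choose i : ℕ) : ℝ) ≤
      Real.exp (4 * η * s) * (1 + Real.exp (-(4 * η))) ^ m := by
    rw [add_comm (1 : ℝ), add_pow, Finset.mul_sum]
    push_cast
    have hsm : s ≤ m := by
      have : (s : ℝ) ≤ m := by nlinarith [Nat.cast_nonneg (α := ℝ) m]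
      exact_mod_cast this
    refine (Finset.sum_le_sum fun i hi => ?_).trans (Finset.sum_le_sum_of_subset_of_nonneg
      (Finset.range_subset_range.mpr (Nat.succ_le_succ hsm)) fun i _ _ => by positivity)
    have his : (i : ℝ) ≤ s := by exact_mod_cast Nat.lt_succ_iff.mp (Finset.mem_range.mp hi)
    rw [one_pow, mul_one, ← mul_assoc, ← Real.exp_nat_mul, ← Real.exp_add]
    refine le_mul_of_one_le_left (Nat.cast_nonneg _) (Real.one_le_exp ?_)
    nlinarith
  have h2 : 1 + Real.exp (-(4 * η)) ≤ 2 * Real.exp (-(2 * η) + 2 * η ^ 2) := by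
    have hc := Real.cosh_le_exp_half_sq (2 * η)
    have he : 1 + Real.exp (-(4 * η)) = 2 * Real.exp (-(2 * η)) * Real.cosh (2 * η) := by
      have e1 : Real.exp (-(2 * η)) * Real.exp (2 * η) = 1 := by rw [← Real.exp_add]; simp
      have e2 : Real.exp (-(2 * η)) * Real.exp (-(2 * η)) = Real.exp (-(4 * η)) := by
        rw [← Real.exp_add]; congr 1; ring
      rw [Real.cosh_eq]
      linear_combination -e1 - e2
    rw [he, Real.exp_add, ← mul_assoc]
    refine mul_le_mul_of_nonneg_left (hc.trans (le_of_eq ?_)) (by positivity)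
    congr 1
    ring
  calc _ ≤ _ := h1
    _ ≤ Real.exp (4 * η * s) * (2 * Real.exp (-(2 * η) + 2 * η ^ 2)) ^ m := by gcongr
    _ = 2 ^ m * Real.exp (4 * η * s + m * (-(2 * η) + 2 * η ^ 2)) := by
      rw [mul_pow, ← Real.exp_nat_mul, Real.exp_add]; ring
    _ ≤ _ := by
      gcongr
      nlinarith

theorem one_sub_exp_le_codeRate (n v : ℕ) (η : ℝ) (hη : 0 ≤ η) (hη' : η ≤ 1 / 2)
    (hv : (1 / 2 + η) * n ≤ v) :
    1 - Real.exp (-(2 * η ^ 2 * n)) ≤ codeRate (reedMuller n v) := by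
  have hs : ((n - v : ℕ) : ℝ) ≤ (1 / 2 - η) * n := by
    rcases le_total v n with h | h
    · rw [Nat.cast_sub h]; linarith
    · rw [Nat.sub_eq_zero_of_le h]
      have : (0 : ℝ) ≤ n := Nat.cast_nonneg n
      simpa using mul_nonneg (by linarith) this
  have h1 := two_pow_le_finrank_polyCode_add (σ := Fin n) v
  rw [Fintype.card_fin] at h1
  have h2 := (Finset.sum_le_sum_of_subset (f := n.choose)
    (Finset.range_subset_range.mpr (Nat.le_succ (n - v))))
  have h3 := sum_range_choose_le n (n - v) η hη hs
  have h4 : (2 : ℝ) ^ n ≤ Module.finrank (ZMod 2) (reedMuller n v) +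
      ((∑ i ∈ Finset.range (n - v + 1), n.choose i : ℕ) : ℝ) := by
    rw [reedMuller_eq_polyCode]
    exact_mod_cast h1.trans (Nat.add_le_add_left h2 _)
  have hpos : (0 : ℝ) < 2 ^ n := by positivity
  rw [codeRate, Fintype.card_fun, ZMod.card, Fintype.card_fin, Nat.cast_pow, Nat.cast_ofNat,
    le_div_iff₀ hpos]
  linarith

/-- A larger degree would leave out only an exponentially small fraction of the monomials, putting
the rate above any constant below `1`. -/
theorem eventually_degree_lt {n v : ℕ → ℕ} (hn : Tendsto n atTop atTop) {R : ℝ} (hR : R < 1)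
    (hrate : Tendsto (fun k => codeRate (reedMuller (n k) (v k))) atTop (𝓝 R))
    {η : ℝ} (hη : 0 < η) (hη' : η ≤ 1 / 2) : ∀ᶠ k in atTop, (v k : ℝ) < (1 / 2 + η) * n k := by
  have hexp : Tendsto (fun k => 1 - Real.exp (-(2 * η ^ 2 * n k))) atTop (𝓝 (1 - 0)) := by
    refine tendsto_const_nhds.sub (Real.tendsto_exp_neg_atTop_nhds_zero.comp ?_)
    exact (tendsto_natCast_atTop_atTop.comp hn).const_mul_atTop (by positivity)
  rw [sub_zero] at hexp
  filter_upwards [hrate.eventually_lt hexp hR] with k hk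
  by_contra! hcon
  exact absurd (one_sub_exp_le_codeRate (n k) (v k) η hη.le hη' hcon) (not_le.mpr hk)

/-- Three votes per variable suffice, because `2 * 27 < 64`. -/
theorem two_pow_mul_three_pow_lt {n : ℕ} (hn : 0 < n) : 2 ^ n * 3 ^ (3 * n) < 4 ^ (3 * n) := by
  rw [pow_mul, pow_mul, ← mul_pow]
  exact Nat.pow_lt_pow_left (by norm_num) hn.ne'

/-- The union bound over the words of weight at most `2 * ρ`, in terms of the logarithm of the
number of words in each dyadic weight range. -/
theorem sum_pow_hammingNorm_le {n v k₀ ρ : ℕ} (hv : v < n) (hρ : 12 * ρ ≤ 2 ^ (n - k₀)) {z : ℝ}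
    (hz : 0 < z) (hz1 : z < 1)
    (hE : ∀ k, k₀ ≤ k → k ≤ v → ((3 * n * ((n - k) * k +
      ∑ i ∈ Finset.range (v - k + 1), (n - k).choose i) : ℕ) : ℝ) ≤
        -Real.log z / 24 * 2 ^ (n - k)) :
    ∑ c ∈ codewords (reedMuller n v) with c ≠ 0 ∧ hammingNorm c ≤ 2 * ρ, z ^ hammingNorm c ≤
      n * Real.exp (-(-Real.log z / 24 * 2 ^ (n - v))) := by
  classical
  set ζ := -Real.log z with hζ
  have hζ0 : 0 < ζ := neg_pos.mpr (Real.log_neg hz hz1)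
  set T := (codewords (reedMuller n v)).filter fun c => c ≠ 0 ∧ hammingNorm c ≤ 2 * ρ with hT
  have ht := two_pow_mul_three_pow_lt (Nat.zero_lt_of_lt hv)
  -- The level is `j - 1` for the first `j` with `2 ^ (n - j) < 6 * wt c`. The weight bound gives `j
  -- > k₀`, and the minimum weight gives `j ≤ v + 1`.
  have hlevel : ∀ c ∈ T, ∃ k, k₀ ≤ k ∧ k ≤ v ∧ 6 * hammingNorm c ≤ 2 ^ (n - k) ∧
      2 ^ (n - k) ≤ 12 * hammingNorm c := by
    intro c hc
    simp only [hT, Finset.mem_filter, BMSChannel.mem_codewords] at hc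
    have hex : ∃ j, 2 ^ (n - j) < 6 * hammingNorm c := by
      refine ⟨v + 1, ?_⟩
      by_contra! hcon
      exact hc.2.1 (eq_zero_of_hammingNorm_le (κ := Fin (v + 1)) (τ := Fin (n - (v + 1)))
        (finSumFinEquiv.trans (finCongr (by omega))) hc.1 (by simp) (by simpa using hcon) (3 * n)
        (by simpa [Nat.add_sub_cancel' (Nat.succ_le_of_lt hv)] using ht))
    have hfind := Nat.find_spec hex
    have hgt : k₀ < Nat.find hex := by
      by_contra! hle
      have : 2 ^ (n - k₀) ≤ 2 ^ (n - Nat.find hex) :=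
        Nat.pow_le_pow_right (by norm_num) (by omega)
      omega
    have hmin := Nat.find_min hex (Nat.sub_lt (Nat.zero_lt_of_lt hgt) one_pos)
    have hle : Nat.find hex ≤ v + 1 := by
      by_contra! hcon
      have h := Nat.find_min hex hcon
      refine hc.2.1 (eq_zero_of_hammingNorm_le (κ := Fin (v + 1)) (τ := Fin (n - (v + 1)))
        (finSumFinEquiv.trans (finCongr (by omega))) hc.1 (by simp) (by simpa using h) (3 * n)
        (by simpa [Nat.add_sub_cancel' (Nat.succ_le_of_lt hv)] using ht))
    have hpow : 2 ^ (n - (Nat.find hex - 1)) = 2 * 2 ^ (n - Nat.find hex) := by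
      rw [← pow_succ']
      congr 1
      omega
    refine ⟨Nat.find hex - 1, by omega, by omega, by omega, by omega⟩
  choose! lev h1 h2 h3 h4 using hlevel
  have hterm : ∀ k ∈ Finset.Icc k₀ v, ∑ c ∈ T with lev c = k, z ^ hammingNorm c ≤
      Real.exp (-(ζ / 24 * 2 ^ (n - v))) := by
    intro k hk
    rw [Finset.mem_Icc] at hk
    have hcard := card_hammingNorm_le (κ := Fin k) (τ := Fin (n - k))
      (finSumFinEquiv.trans (finCongr (by omega) : Fin (k + (n - k)) ≃ Fin n)) v (3 * n)
      (by simpa [Nat.add_sub_cancel' (hk.2.trans hv.le)] using ht) (T.filter fun c => lev c = k)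
      (fun c hc => by
        rw [Finset.mem_filter] at hc
        have hc' := hc.1
        simp only [hT, Finset.mem_filter, BMSChannel.mem_codewords] at hc'
        refine ⟨hc'.1, ?_⟩
        rw [Fintype.card_fin, ← hc.2]
        exact h3 c hc.1)
    simp only [Fintype.card_fin] at hcard
    set E := 3 * n * ((n - k) * k + ∑ i ∈ Finset.range (v - k + 1), (n - k).choose i) with hEdef
    have hEk : (E : ℝ) ≤ ζ / 24 * 2 ^ (n - k) := hE k hk.1 hk.2
    -- The count uses half of the decay `ζ / 12` available from `wt c ≥ 2 ^ (n - k) / 12`; the other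
    -- half is left as the bound.
    have hcard' : ((T.filter fun c => lev c = k).card : ℝ) ≤ Real.exp (ζ / 24 * 2 ^ (n - k)) := by
      calc ((T.filter fun c => lev c = k).card : ℝ) ≤ 2 ^ E := by exact_mod_cast hcard
        _ ≤ Real.exp 1 ^ E := by
          gcongr
          linarith [Real.add_one_le_exp (1 : ℝ)]
        _ = Real.exp E := by rw [← Real.exp_nat_mul, mul_one]
        _ ≤ _ := Real.exp_le_exp.mpr hEk
    have hz' : ∀ c ∈ T.filter fun c => lev c = k,
        z ^ hammingNorm c ≤ Real.exp (-(ζ / 12 * 2 ^ (n - k))) := by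
      intro c hc
      rw [Finset.mem_filter] at hc
      have h := h4 c hc.1
      rw [hc.2] at h
      have h' : (2 : ℝ) ^ (n - k) ≤ 12 * hammingNorm c := by exact_mod_cast h
      rw [← Real.exp_log hz, ← Real.exp_nat_mul, Real.exp_le_exp]
      have : Real.log z = -ζ := by rw [hζ, neg_neg]
      rw [this]
      nlinarith
    calc _ ≤ ∑ c ∈ T with lev c = k, Real.exp (-(ζ / 12 * 2 ^ (n - k))) := Finset.sum_le_sum hz'
      _ = (T.filter fun c => lev c = k).card * Real.exp (-(ζ / 12 * 2 ^ (n - k))) := by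
        rw [Finset.sum_const, nsmul_eq_mul]
      _ ≤ Real.exp (ζ / 24 * 2 ^ (n - k)) * Real.exp (-(ζ / 12 * 2 ^ (n - k))) := by gcongr
      _ = Real.exp (-(ζ / 24 * 2 ^ (n - k))) := by
        rw [← Real.exp_add]; congr 1; ring
      _ ≤ _ := by
        gcongr
        · norm_num
        · exact hk.2
  rw [← Finset.sum_fiberwise_of_maps_to (g := lev) (t := Finset.Icc k₀ v)
    fun c hc => Finset.mem_Icc.mpr ⟨h1 c hc, h2 c hc⟩]
  refine (Finset.sum_le_sum hterm).trans ?_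
  rw [Finset.sum_const, nsmul_eq_mul, Nat.card_Icc]
  gcongr
  omega

/-- The number of words in each dyadic weight range is subexponential in the weight. -/
theorem weight_exponent_le {n v k : ℕ} {η ε : ℝ} (hη : 0 ≤ η)
    (hv : (v : ℝ) ≤ (1 / 2 + η) * n) (hk : 4 * η * n ≤ k) (hkv : k ≤ v) (hvn : v < n)
    (hε : 3 * (n : ℝ) ^ 3 * Real.exp (-(Real.log 2 / 4 * n)) +
      3 * n * Real.exp (-(η ^ 2 / 2 * n)) ≤ ε) :
    ((3 * n * ((n - k) * k + ∑ i ∈ Finset.range (v - k + 1), (n - k).choose i) : ℕ) : ℝ) ≤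
      ε * 2 ^ (n - k) := by
  have hn0 : (0 : ℝ) ≤ n := Nat.cast_nonneg n
  have hkn : k ≤ n := hkv.trans hvn.le
  have hm : ((n - k : ℕ) : ℝ) = n - k := Nat.cast_sub hkn
  have hkv' : (k : ℝ) ≤ v := by exact_mod_cast hkv
  have hk0 : (0 : ℝ) ≤ k := Nat.cast_nonneg k
  have hkn' : (k : ℝ) ≤ n := by exact_mod_cast hkn
  -- From `4 * η * n ≤ k ≤ (1 / 2 + η) * n` one gets `η * n ≤ n / 6`, so `k ≤ 2 * n / 3`.
  have hm4 : (n : ℝ) / 4 ≤ (n - k : ℕ) := by rw [hm]; nlinarith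
  have hs : ((v - k : ℕ) : ℝ) ≤ (1 / 2 - η) * (n - k : ℕ) := by
    rw [Nat.cast_sub hkv, hm]; nlinarith
  have h1 := sum_range_choose_le (n - k) (v - k) η hη hs
  have h2 : (1 : ℝ) ≤ 2 ^ (n - k) * Real.exp (-(Real.log 2 / 4 * n)) := by
    rw [← Real.exp_log (show (0 : ℝ) < 2 ^ (n - k) by positivity), ← Real.exp_add, Real.log_pow]
    refine Real.one_le_exp ?_
    nlinarith [Real.log_pos (show (1 : ℝ) < 2 by norm_num)]
  have h3 : Real.exp (-(2 * η ^ 2 * (n - k : ℕ))) ≤ Real.exp (-(η ^ 2 / 2 * n)) := by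
    rw [Real.exp_le_exp]
    nlinarith [sq_nonneg η]
  rw [Nat.cast_mul, Nat.cast_add]
  have h4 : (((n - k) * k : ℕ) : ℝ) ≤ n ^ 2 := by
    rw [Nat.cast_mul, hm]; nlinarith
  calc _ ≤ ((3 * n : ℕ) : ℝ) * ((n : ℝ) ^ 2 * (2 ^ (n - k) * Real.exp (-(Real.log 2 / 4 * n))) +
        2 ^ (n - k) * Real.exp (-(η ^ 2 / 2 * n))) := by
        refine mul_le_mul_of_nonneg_left (add_le_add ?_ (h1.trans ?_)) (Nat.cast_nonneg _)
        · exact h4.trans (le_mul_of_one_le_right (by positivity) h2)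
        · gcongr
    _ = (3 * (n : ℝ) ^ 3 * Real.exp (-(Real.log 2 / 4 * n)) +
        3 * n * Real.exp (-(η ^ 2 / 2 * n))) * 2 ^ (n - k) := by push_cast; ring
    _ ≤ _ := by gcongr

theorem tendsto_pow_mul_exp_neg (j : ℕ) {a : ℝ} (ha : 0 < a) :
    Tendsto (fun n : ℕ => (n : ℝ) ^ j * Real.exp (-(a * n))) atTop (𝓝 0) := by
  have h := (Real.tendsto_pow_mul_exp_neg_atTop_nhds_zero j).comp
    ((tendsto_natCast_atTop_atTop (R := ℝ)).const_mul_atTop ha)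
  have h' := h.const_mul ((a ^ j)⁻¹)
  rw [mul_zero] at h'
  refine h'.congr fun n => ?_
  simp only [Function.comp_apply, mul_pow]
  field_simp

/-- The union bound over the codewords of weight `O(2 ^ (n * (1 - δ / 2)))` vanishes. -/
theorem tendsto_sum_pow_hammingNorm {n v : ℕ → ℕ} (hn : Tendsto n atTop atTop) {R : ℝ} (hR : R < 1)
    (hrate : Tendsto (fun k => codeRate (reedMuller (n k) (v k))) atTop (𝓝 R))
    {z : ℝ} (hz : 0 < z) (hz1 : z < 1) {δ : ℝ} (hδ : 0 < δ) :
    Tendsto (fun k => ∑ c ∈ codewords (reedMuller (n k) (v k)) with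
      c ≠ 0 ∧ hammingNorm c ≤ 2 * ⌊(2 : ℝ) ^ (n k * (1 - δ / 2))⌋₊, z ^ hammingNorm c)
      atTop (𝓝 0) := by
  -- `η ≤ 1 / 8` keeps `n - v` at least `n / 4`; `η ≤ δ / 16` makes `4 * η * n ≤ δ * n / 4`, leaving
  -- room for `12 * ρ ≤ 2 ^ (n - k₀)`.
  set η := min (1 / 8) (δ / 16) with hη
  have hη0 : 0 < η := lt_min (by norm_num) (by positivity)
  have hη8 : η ≤ 1 / 8 := min_le_left _ _
  have hηδ : η ≤ δ / 16 := min_le_right _ _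
  set ε := -Real.log z / 24 with hε
  have hε0 : 0 < ε := div_pos (neg_pos.mpr (Real.log_neg hz hz1)) (by norm_num)
  have hlog2 : 0 < Real.log 2 := Real.log_pos (by norm_num)
  have hlim : Tendsto (fun m : ℕ => 3 * (m : ℝ) ^ 3 * Real.exp (-(Real.log 2 / 4 * m)) +
      3 * m * Real.exp (-(η ^ 2 / 2 * m))) atTop (𝓝 0) := by
    have ha := (tendsto_pow_mul_exp_neg 3 (show 0 < Real.log 2 / 4 by positivity)).const_mul 3
    have hb := (tendsto_pow_mul_exp_neg 1 (show 0 < η ^ 2 / 2 by positivity)).const_mul 3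
    have hab := ha.add hb
    simp only [mul_zero, add_zero, pow_one, ← mul_assoc] at hab
    exact hab
  have hdelta : Tendsto (fun m : ℕ => δ / 4 * (m : ℝ)) atTop atTop :=
    tendsto_natCast_atTop_atTop.const_mul_atTop (by positivity)
  have hbound := ((tendsto_pow_mul_exp_neg 1 (show 0 < ε / 4 by positivity)).comp hn)
  refine squeeze_zero' (Eventually.of_forall fun k =>
    Finset.sum_nonneg fun c _ => pow_nonneg hz.le _) ?_ hbound
  filter_upwards [eventually_degree_lt hn hR hrate hη0 (by linarith), hn.eventually_gt_atTop 0,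
    -- The `5` pays `4` for the factor `12 ≤ 2 ^ 4` and `1` for the ceiling in `k₀`.
    (hlim.comp hn).eventually_le_const hε0, (hdelta.comp hn).eventually_ge_atTop 5]
    with k hv hn0 hlimk hdk
  simp only [Function.comp_apply] at hlimk hdk ⊢
  have hn0' : (0 : ℝ) < n k := by exact_mod_cast hn0
  have hvn : v k < n k := by
    have : (v k : ℝ) < n k := by nlinarith
    exact_mod_cast this
  refine (sum_pow_hammingNorm_le hvn (k₀ := ⌈4 * η * n k⌉₊) ?_ hz hz1 fun j hj hjv =>
    weight_exponent_le hη0.le hv.le ((Nat.le_ceil _).trans (by exact_mod_cast hj))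
      hjv hvn hlimk).trans ?_
  · have hceil := Nat.ceil_lt_add_one (show 0 ≤ 4 * η * n k by positivity)
    have hsub : (n k : ℝ) - ⌈4 * η * n k⌉₊ ≤ ((n k - ⌈4 * η * n k⌉₊ : ℕ) : ℝ) := by
      rw [sub_le_iff_le_add]
      exact_mod_cast le_tsub_add
    have hfl := Nat.floor_le (show (0 : ℝ) ≤ (2 : ℝ) ^ (n k * (1 - δ / 2)) by positivity)
    have h16 : (12 : ℝ) ≤ (2 : ℝ) ^ (4 : ℝ) := by norm_num
    have : (12 : ℝ) * ⌊(2 : ℝ) ^ (n k * (1 - δ / 2))⌋₊ ≤ 2 ^ (n k - ⌈4 * η * n k⌉₊) := by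
      calc _ ≤ (2 : ℝ) ^ (4 : ℝ) * (2 : ℝ) ^ (n k * (1 - δ / 2)) := by gcongr
        _ = (2 : ℝ) ^ (4 + n k * (1 - δ / 2)) := by rw [← Real.rpow_add two_pos]
        _ ≤ (2 : ℝ) ^ ((n k - ⌈4 * η * n k⌉₊ : ℕ) : ℝ) := by
          refine Real.rpow_le_rpow_of_exponent_le one_le_two (le_trans ?_ hsub)
          nlinarith
        _ = _ := Real.rpow_natCast _ _
    exact_mod_cast this
  · rw [pow_one]
    refine mul_le_mul_of_nonneg_left (Real.exp_le_exp.mpr (neg_le_neg ?_)) hn0'.le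
    have h2 : ((n k - v k : ℕ) : ℝ) ≤ 2 ^ (n k - v k) := by
      exact_mod_cast Nat.lt_two_pow_self.le
    rw [Nat.cast_sub hvn.le] at h2
    have h3 : (n k : ℝ) / 4 ≤ 2 ^ (n k - v k) := by nlinarith
    calc ε / 4 * n k = ε * (n k / 4) := by ring
      _ ≤ _ := mul_le_mul_of_nonneg_left h3 hε0.le

end Asymptotics

theorem theorem1
    -- the sequence of codes `RM(n k, v k)`, of increasing `n k`, whose rates converge to `R`
    (n v : ℕ → ℕ) (hn : StrictMono n)
    (R : ℝ) (hR : R ∈ Set.Ioo (0 : ℝ) 1)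
    (hrate : Tendsto (fun k => codeRate (reedMuller (n k) (v k))) atTop (𝓝 R))
    -- the channels, all with Bhattacharyya parameter `z`
    {Y : ℕ → Type*} [∀ k, MeasurableSpace (Y k)] (W : ∀ k, BMSChannel (Y k))
    (z : ℝ) (hz : z ∈ Set.Ioo (0 : ℝ) 1) (hW : ∀ k, (W k).bhattacharyya = z)
    -- the bit-MAP and block-MAP decoders
    (dbit : ∀ k, (Fin (n k) → ZMod 2) → (((Fin (n k) → ZMod 2) → Y k) → ZMod 2))
    (hdbit : ∀ k, (W k).IsBitMAP (reedMuller (n k) (v k)) (dbit k))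
    (dblock : ∀ k, ((Fin (n k) → ZMod 2) → Y k) → ((Fin (n k) → ZMod 2) → ZMod 2))
    (hdblock : ∀ k, (W k).IsBlockMAP (reedMuller (n k) (v k)) (dblock k))
    -- the decay of the bit error probability
    (δ : ℝ) (hδ : 0 < δ)
    (hbit : (fun k => (W k).bitError (reedMuller (n k) (v k)) (dbit k)) =O[atTop]
      (fun k => (2 : ℝ) ^ (-((n k : ℝ) * δ)))) :
    Tendsto (fun k => (W k).blockError (reedMuller (n k) (v k)) (dblock k)) atTop (𝓝 0) := by
  have hnt : Tendsto n atTop atTop := hn.tendsto_atTop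
  obtain ⟨A, hA⟩ := hbit.bound
  have hterm : Tendsto (fun k => A * (2 : ℝ) ^ (-(n k * (δ / 2)))) atTop (𝓝 0) := by
    have h1 : Tendsto (fun k => δ / 2 * (n k : ℝ)) atTop atTop :=
      (tendsto_natCast_atTop_atTop.comp hnt).const_mul_atTop (by positivity)
    have h2 := (tendsto_rpow_atBot_of_base_gt_one 2 one_lt_two).comp
      (tendsto_neg_atTop_atBot.comp h1)
    have h3 := h2.const_mul A
    rw [mul_zero] at h3
    refine h3.congr fun k => ?_
    simp only [Function.comp_apply]
    rw [mul_comm (δ / 2)]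
  have hsum := tendsto_sum_pow_hammingNorm hnt hR.2 hrate hz.1 hz.2 hδ
  have hlim := hterm.add hsum
  rw [add_zero] at hlim
  refine squeeze_zero' (Eventually.of_forall fun k => ?_) ?_ hlim
  · exact div_nonneg (Finset.sum_nonneg fun _ _ => measureReal_nonneg) (Nat.cast_nonneg _)
  · filter_upwards [hA] with k hk
    -- This radius splits the decay evenly: the Markov term is at most `A * 2 ^ (-n * δ / 2)`, while
    -- `ρ` stays below `N` by a factor of about `2 ^ (n * δ / 2)`.
    refine ((W k).blockError_le (hdblock k) (hdbit k).measurable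
      ⌊(2 : ℝ) ^ (n k * (1 - δ / 2))⌋₊).trans ?_
    rw [hW k]
    refine add_le_add ?_ le_rfl
    have hfl := (Nat.lt_floor_add_one ((2 : ℝ) ^ (n k * (1 - δ / 2)))).le
    have hpos : (0 : ℝ) < (2 : ℝ) ^ (n k * (1 - δ / 2)) := by positivity
    have hk' : (W k).bitError (reedMuller (n k) (v k)) (dbit k) ≤
        A * (2 : ℝ) ^ (-((n k : ℝ) * δ)) := by
      refine (Real.le_norm_self _).trans (hk.trans (le_of_eq ?_))
      rw [Real.norm_of_nonneg (by positivity)]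
    have hbit0 : 0 ≤ (W k).bitError (reedMuller (n k) (v k)) (dbit k) :=
      div_nonneg (Finset.sum_nonneg fun _ _ => div_nonneg
        (Finset.sum_nonneg fun _ _ => measureReal_nonneg) (Nat.cast_nonneg _)) (Nat.cast_nonneg _)
    have hcard : (Fintype.card (Fin (n k) → ZMod 2) : ℝ) = (2 : ℝ) ^ (n k : ℝ) := by
      rw [Fintype.card_fun, ZMod.card, Fintype.card_fin, Real.rpow_natCast]
      push_cast
      rfl
    rw [hcard]
    calc _ ≤ (2 : ℝ) ^ (n k : ℝ) / (2 : ℝ) ^ (n k * (1 - δ / 2)) *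
          (A * (2 : ℝ) ^ (-((n k : ℝ) * δ))) := by gcongr
      _ = A * ((2 : ℝ) ^ (n k : ℝ) / (2 : ℝ) ^ (n k * (1 - δ / 2)) *
          (2 : ℝ) ^ (-((n k : ℝ) * δ))) := by ring
      _ = _ := by
        rw [← Real.rpow_sub two_pos, ← Real.rpow_add two_pos]
        congr 2
        ring
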